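/- Let $\mathbb M_n$ denote the complex $n\times n$ matrices and $\mathbb M_n^+$ the positive semidefinite ones. For $A\in\mathbb M_m^+$ with spectral decomposition $A=\sum_i\lambda_iE_i$ and $s\in\mathbb R$, let $A^s:=\sum_{\lambda_i>0}\lambda_i^sE_i$ (so negative powers are generalized inverses and $A^0$ is the range projection of $A$). A norm on $\mathbb M_n$ is called symmetric if $\|UXV\|=\|X\|$ for all $X\in\mathbb M_n$ and all unitary $U,V\in\mathbb M_n$. A function $f\ge 0$ on a convex set is called log-convex if $f((1-\theta)x+\theta y)\le f(x)^{1-\theta}f(y)^{\theta}$ for all $x,y$ in the set and $\theta\in[0,1]$, where $0^0=1$. (i) Let $A\in\mathbb M_m^+$ and let $\Phi:\mathbb M_m\to\mathbb M_n$ be a positive linear map. Then, for all symmetric norms on $\mathbb M_n$ and all $\alpha>0$, the map $$(p,t)\mapsto\left\|\left\{\Phi(A^{t/p})\right\}^{\alpha p}\right\|$$ is jointly log-convex on $(0,\infty)\times(-\infty,\infty)$. (ii) Every positive linear map $\Psi:\mathcal A\to\mathbb M_n$ defined on a commutative $*$-subalgebra $\mathcal A$ (not necessarily containing the identity) of $\mathbb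 M_m$ is completely positive: whenever $X_{ij}\in\mathcal A$ $(1\le i,j\le k)$ and the block matrix $[X_{ij}]$ is positive semidefinite, so is $[\Psi(X_{ij})]$. -/

import Mathlib

open scoped ComplexOrder MatrixOrder

/-- The real power `A ^ s` (`s : ℝ`) of a positive semidefinite matrix `A`, with the generalized
inverse convention: on a spectral decomposition `A = ∑ λᵢ Eᵢ` it is the sum of `λᵢ ^ s Eᵢ` over the
*nonzero* eigenvalues. So `A ^ 0` is the range projection `E` of `A`, and for `t ≥ 0`
`A ^ (-t) = (A + F) ^ (-t) E`, with `F` the projection onto the null space of `A`. -/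
noncomputable def psdPow {n : ℕ} (A : Matrix (Fin n) (Fin n) ℂ) (s : ℝ) :
    Matrix (Fin n) (Fin n) ℂ :=
  cfc (fun x : ℝ => if x = 0 then 0 else x ^ s) A

/-- A symmetric norm on the complex `n × n` matrices: a norm (a seminorm that vanishes only at `0`)
that is invariant under multiplication by unitaries on both sides. -/
structure IsSymmetricNorm {n : ℕ} (N : Seminorm ℂ (Matrix (Fin n) (Fin n) ℂ)) : Prop where
  eq_zero : ∀ X, N X = 0 → X = 0
  unitary_mul_mul : ∀ U ∈ Matrix.unitaryGroup (Fin n) ℂ, ∀ V ∈ Matrix.unitaryGroup (Fin n) ℂ,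
    ∀ X, N (U * X * V) = N X

/-- Log-convexity of a nonnegative function `f` on a convex set `s`; zero values of `f`
are allowed (then `log f = -∞`). -/
def LogConvexOn {E : Type*} [AddCommGroup E] [Module ℝ E] (s : Set E) (f : E → ℝ) : Prop :=
  Convex ℝ s ∧ (∀ x ∈ s, 0 ≤ f x) ∧
    ∀ x ∈ s, ∀ y ∈ s, ∀ a b : ℝ, 0 ≤ a → 0 ≤ b → a + b = 1 →
      f (a • x + b • y) ≤ f x ^ a * f y ^ b

/-- Complete positivity of a linear map `Ψ` from a `*`-subalgebra `𝒜` of the `m × m` matrices to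
the `n × n` matrices: for every `k` and every `k × k` array `X` with entries in `𝒜` whose
`km × km` block matrix is positive semidefinite, the `kn × kn` block matrix of the images `Ψ (X i j)`
is positive semidefinite. -/
def IsCompletelyPositive {m n : ℕ} {𝒜 : NonUnitalStarSubalgebra ℂ (Matrix (Fin m) (Fin m) ℂ)}
    (Ψ : 𝒜 →ₗ[ℂ] Matrix (Fin n) (Fin n) ℂ) : Prop :=
  ∀ (k : ℕ) (X : Matrix (Fin k) (Fin k) 𝒜),
    (Matrix.comp _ _ _ _ ℂ (X.map fun Y => (Y : Matrix (Fin m) (Fin m) ℂ))).PosSemidef →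
      (Matrix.comp _ _ _ _ ℂ (X.map fun Y => Ψ Y)).PosSemidef

/-! (i) Factoring the images under Φ of the rank-one spectral projections of A gives one matrix Z
with Φ(f(A)) = Zᴴ f(L) Z for every f, L diagonal (`exists_map_cfc_eq`). By Cauchy–Binet, each k × k
determinant of a compression of Zᴴ D Z is a nonnegative combination of products of entries of D, so
Hölder makes it log-convex in D. Compressing to eigenvectors of the middle operator gives
log-convexity of the products of the k largest eigenvalues (`prod_range_eigenvalues_le`). Fan
dominance and Young's inequality carry this weak log-majorization over to every symmetric norm. (ii)
A commutative *-algebra is diagonal in a basis of joint eigenvectors, so X = ∑ cᵢ χᵢ(X) Eᵢ with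
characters χᵢ and projections Eᵢ. Hence [Ψ(X_ab)] = ∑ cᵢ [χᵢ(X_ab)] ⊗ Ψ(Eᵢ), a sum of positive
semidefinite terms. -/

/-! ### Weak log-majorization and weighted sums. -/

/-- Abel summation in inductive form: lowering `u n` to `u (n + 1)` costs nothing because the
partial sums of `d` are nonnegative. -/
theorem mul_sum_range_le_sum_range_mul_of_antitone {u d : ℕ → ℝ} (hu : Antitone u)
    {n : ℕ} (hd : ∀ k ≤ n, 0 ≤ ∑ i ∈ Finset.range k, d i) :
    u n * ∑ i ∈ Finset.range n, d i ≤ ∑ i ∈ Finset.range n, u i * d i := by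
  induction n with
  | zero => simp
  | succ n ih =>
    have h1 := ih fun k hk => hd k (by omega)
    have h2 := mul_le_mul_of_nonneg_right (hu n.le_succ) (hd (n + 1) le_rfl)
    rw [Finset.sum_range_succ (fun i => u i * d i)]
    have h3 := Finset.sum_range_succ d n
    rw [h3] at h2 ⊢
    nlinarith

/-- Weak log-majorization implies weak majorization, in a weighted form. -/
theorem sum_range_mul_le_of_prod_range_le {x y w : ℕ → ℝ} (hx : Antitone x) (hx0 : ∀ i, 0 ≤ x i)
    (hy0 : ∀ i, 0 ≤ y i) (hw : Antitone w) (hw0 : ∀ i, 0 ≤ w i) {n : ℕ}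
    (h : ∀ k ≤ n, ∏ i ∈ Finset.range k, x i ≤ ∏ i ∈ Finset.range k, y i) :
    ∑ i ∈ Finset.range n, w i * x i ≤ ∑ i ∈ Finset.range n, w i * y i := by
  induction n with
  | zero => simp
  | succ n ih =>
    -- A vanishing last term can be dropped. Otherwise all x are positive, and the full product
    -- forces all y to be positive, so logarithms make sense.
    rcases (hx0 n).eq_or_lt with hn | hn
    · rw [Finset.sum_range_succ, Finset.sum_range_succ, ← hn]
      have := ih fun k hk => h k (by omega)
      have := mul_nonneg (hw0 n) (hy0 n)
      linarith
    · have hxp : ∀ i ∈ Finset.range (n + 1), 0 < x i := fun i hi =>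
        hn.trans_le (hx (by simpa [Nat.lt_succ_iff] using hi))
      have hyp : ∀ i ∈ Finset.range (n + 1), 0 < y i := fun i hi => by
        refine (hy0 i).lt_of_ne fun h0 => ?_
        have := h (n + 1) le_rfl
        rw [Finset.prod_eq_zero hi h0.symm] at this
        exact (Finset.prod_pos hxp).not_ge this
      have hd : ∀ k ≤ n + 1, 0 ≤ ∑ i ∈ Finset.range k, Real.log (y i / x i) := fun k hk => by
        have hs : ∀ i ∈ Finset.range k, i ∈ Finset.range (n + 1) := fun i hi =>
          Finset.range_subset_range.2 hk hi
        rw [← Real.log_prod fun i hi => (div_pos (hyp i (hs i hi)) (hxp i (hs i hi))).ne',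
          Finset.prod_div_distrib]
        refine Real.log_nonneg ?_
        rw [one_le_div (Finset.prod_pos fun i hi => hxp i (hs i hi))]
        exact h k hk
      have hu : Antitone fun i => w i * x i := fun i j hij =>
        mul_le_mul (hw hij) (hx hij) (hx0 _) (hw0 _)
      have h1 := mul_sum_range_le_sum_range_mul_of_antitone hu hd
      have h2 := mul_nonneg (mul_nonneg (hw0 (n + 1)) (hx0 (n + 1))) (hd (n + 1) le_rfl)
      -- From x log(y/x) ≤ y - x; the left side is nonnegative by Abel summation with the decreasing
      -- weights w x.
      have h3 : ∑ i ∈ Finset.range (n + 1), w i * x i * Real.log (y i / x i) ≤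
          ∑ i ∈ Finset.range (n + 1), (w i * y i - w i * x i) := by
        refine Finset.sum_le_sum fun i hi => ?_
        have h4 := Real.log_le_sub_one_of_pos (div_pos (hyp i hi) (hxp i hi))
        have h5 := mul_le_mul_of_nonneg_left h4 (mul_nonneg (hw0 i) (hx0 i))
        have h6 : w i * x i * (y i / x i - 1) = w i * y i - w i * x i := by
          have := (hxp i hi).ne'
          field_simp
        linarith
      rw [Finset.sum_sub_distrib] at h3
      linarith

/-! ### Fan dominance for symmetric norms. -/

namespace IsSymmetricNorm

open Matrix

variable {n : ℕ} {N : Seminorm ℂ (Matrix (Fin n) (Fin n) ℂ)}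

theorem apply_diagonal_comp_perm (hN : IsSymmetricNorm N) (σ : Equiv.Perm (Fin n))
    (d : Fin n → ℂ) : N (diagonal (d ∘ σ)) = N (diagonal d) := by
  have hU : ∀ τ : Equiv.Perm (Fin n), τ.permMatrix ℂ ∈ unitaryGroup (Fin n) ℂ := fun τ => by
    rw [mem_unitaryGroup_iff, star_eq_conjTranspose, conjTranspose_permMatrix,
      ← permMatrix_mul]
    simp
  rw [← hN.unitary_mul_mul _ (hU σ) _ (hU σ⁻¹) (diagonal d)]
  congr 1
  rw [PEquiv.toMatrix_toPEquiv_mul, PEquiv.mul_toMatrix_toPEquiv]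
  ext i j
  have : (Equiv.symm σ⁻¹) j = σ j := rfl
  simp [diagonal_apply, this]

theorem apply_diagonal_mul_sign (hN : IsSymmetricNorm N) (s d : Fin n → ℂ)
    (hs : ∀ i, s i * star (s i) = 1) : N (diagonal (s * d)) = N (diagonal d) := by
  have hU : diagonal s ∈ unitaryGroup (Fin n) ℂ := by
    rw [mem_unitaryGroup_iff, star_eq_conjTranspose, diagonal_conjTranspose, diagonal_mul_diagonal]
    simp only [Pi.star_apply, hs, diagonal_one]
  rw [← hN.unitary_mul_mul _ hU _ (one_mem _) (diagonal d), mul_one, diagonal_mul_diagonal]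
  rfl

end IsSymmetricNorm

/-- Hahn–Banach: extend c x ↦ c p(x) from the line through x. -/
theorem Seminorm.exists_dual_apply_eq {E : Type*} [AddCommGroup E] [Module ℝ E] (p : Seminorm ℝ E)
    (x : E) : ∃ φ : E →ₗ[ℝ] ℝ, φ x = p x ∧ ∀ v, φ v ≤ p v := by
  rcases eq_or_ne x 0 with rfl | hx
  · exact ⟨0, by simp, fun v => by simp⟩
  obtain ⟨φ, h1, h2⟩ := exists_extension_of_le_sublinear
    (LinearPMap.mkSpanSingleton x (p x) hx) p
    (fun c hc v => by rw [map_smul_eq_mul, Real.norm_of_nonneg hc.le])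
    (fun v w => map_add_le_add p v w) (by
      rintro ⟨v, hv⟩
      obtain ⟨c, rfl⟩ := Submodule.mem_span_singleton.1 (show v ∈ Submodule.span ℝ {x} from hv)
      rw [LinearPMap.mkSpanSingleton'_apply, map_smul_eq_mul, smul_eq_mul]
      exact mul_le_mul_of_nonneg_right (le_abs_self c) (apply_nonneg p x))
  refine ⟨φ, ?_, h2⟩
  have hx' : x ∈ (LinearPMap.mkSpanSingleton x (p x) hx : E →ₗ.[ℝ] ℝ).domain :=
    Submodule.mem_span_singleton_self (R := ℝ) x
  exact (h1 ⟨x, hx'⟩).trans (LinearPMap.mkSpanSingleton'_apply_self _ _ _ _)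

/-- The restriction of a seminorm to the real diagonal matrices. -/
noncomputable def Seminorm.realDiagonal {n : ℕ} (N : Seminorm ℂ (Matrix (Fin n) (Fin n) ℂ)) :
    Seminorm ℝ (Fin n → ℝ) :=
  (N.restrictScalars ℝ).comp
    (Matrix.diagonalLinearMap (Fin n) ℝ ℂ ∘ₗ Complex.ofRealCLM.toLinearMap.compLeft (Fin n))

theorem Seminorm.realDiagonal_apply {n : ℕ} (N : Seminorm ℂ (Matrix (Fin n) (Fin n) ℂ))
    (x : Fin n → ℝ) : N.realDiagonal x = N (Matrix.diagonal fun i => (x i : ℂ)) := rfl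

/-- Fan dominance for symmetric norms, under weak log-majorization. -/
theorem IsSymmetricNorm.realDiagonal_le_of_prod_range_le {n : ℕ}
    {N : Seminorm ℂ (Matrix (Fin n) (Fin n) ℂ)} (hN : IsSymmetricNorm N) {x y : ℕ → ℝ}
    (hx : Antitone x) (hx0 : ∀ i, 0 ≤ x i) (hy0 : ∀ i, 0 ≤ y i)
    (h : ∀ k ≤ n, ∏ i ∈ Finset.range k, x i ≤ ∏ i ∈ Finset.range k, y i) :
    N.realDiagonal (fun i => x i) ≤ N.realDiagonal (fun i => y i) := by
  obtain ⟨φ, h1, h2⟩ := N.realDiagonal.exists_dual_apply_eq (fun i => x i)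
  set w : Fin n → ℝ := fun i => φ (Pi.single i 1) with hw
  have hφ : ∀ v, φ v = ∑ i, w i * v i := fun v => by
    conv_lhs => rw [← Finset.univ_sum_single v, map_sum]
    refine Finset.sum_congr rfl fun i _ => ?_
    have : Pi.single i (v i) = v i • (Pi.single i 1 : Fin n → ℝ) := by
      rw [← Pi.single_smul, smul_eq_mul, mul_one]
    rw [this, map_smul, smul_eq_mul, mul_comm]
  obtain ⟨σ, hσ⟩ : ∃ σ : Equiv.Perm (Fin n), Antitone fun i => |w (σ i)| :=
    ⟨Tuple.sort fun i => -|w i|, fun i j hij =>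
      neg_le_neg_iff.1 (Tuple.monotone_sort (fun i => -|w i|) hij)⟩
  set v : ℕ → ℝ := fun i => if hi : i < n then |w (σ ⟨i, hi⟩)| else 0 with hv
  have hv0 : ∀ i, 0 ≤ v i := fun i => by
    simp only [hv]; split_ifs <;> positivity
  have hva : Antitone v := fun i j hij => by
    by_cases hj : j < n
    · simp only [hv, hj, hij.trans_lt hj, dif_pos]
      exact hσ (by simpa using hij)
    · rw [show v j = 0 by simp [hv, hj]]
      exact hv0 i
  have hvσ : ∀ i : Fin n, |w (σ i)| = v i := fun i => by simp [hv]
  -- The norm ignores signs and permutations, so φ may be tested on s · (y ∘ σ⁻¹): this replaces w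
  -- by |w| and pairs y with |w| in decreasing order. No monotonicity of y is needed.
  set s : Fin n → ℝ := fun i => if 0 ≤ w i then 1 else -1 with hs
  have hsw : ∀ i, w i * s i = |w i| := fun i => by
    simp only [hs]
    split_ifs with h0
    · rw [abs_of_nonneg h0, mul_one]
    · rw [abs_of_neg (not_le.1 h0), mul_neg, mul_one]
  calc N.realDiagonal (fun i => x i) = ∑ i, w i * x i := by rw [← h1, hφ]
    _ ≤ ∑ i, |w i| * x i :=
      Finset.sum_le_sum fun i _ => mul_le_mul_of_nonneg_right (le_abs_self _) (hx0 _)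
    _ = ∑ i, |w (σ (σ⁻¹ i))| * x i := by simp
    _ ≤ ∑ i, |w (σ i)| * x i := by
      have : Monovary (fun i => |w (σ i)|) (fun i : Fin n => x i) := fun i j hij =>
        hσ (le_of_not_ge fun hc => hij.not_ge (hx (by simpa using hc)))
      exact this.sum_comp_perm_mul_le_sum_mul
    _ ≤ ∑ i, |w (σ i)| * y i := by
      simp only [hvσ, Fin.sum_univ_eq_sum_range (fun i => v i * x i),
        Fin.sum_univ_eq_sum_range (fun i => v i * y i)]
      exact sum_range_mul_le_of_prod_range_le hx hx0 hy0 hva hv0 h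
    _ = ∑ i, |w i| * y (σ⁻¹ i : Fin n) := by
      rw [← Equiv.sum_comp σ fun i => |w i| * y (σ⁻¹ i : Fin n)]
      simp
    _ = φ (fun i => s i * y (σ⁻¹ i : Fin n)) := by
      rw [hφ]
      simp only [← mul_assoc, hsw]
    _ ≤ N.realDiagonal (fun i => s i * y (σ⁻¹ i : Fin n)) := h2 _
    _ = N.realDiagonal (fun i => y i) := by
      simp only [Seminorm.realDiagonal_apply, Complex.ofReal_mul]
      rw [← hN.apply_diagonal_comp_perm σ⁻¹ fun i => (y i : ℂ)]
      refine hN.apply_diagonal_mul_sign (fun i => (s i : ℂ)) _ fun i => ?_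
      simp only [hs]
      split_ifs <;> simp

/-! ### Cauchy–Binet and log-convexity of eigenvalue products. -/

theorem prod_le_prod_range_card_of_antitone {d : ℕ → ℝ} (hd : Antitone d) (hd0 : ∀ i, 0 ≤ d i)
    (s : Finset ℕ) : ∏ i ∈ s, d i ≤ ∏ i ∈ Finset.range s.card, d i := by
  induction s using Finset.induction_on_max with
  | empty => simp
  | insert a s ha ih =>
    have has : a ∉ s := fun h => lt_irrefl a (ha a h)
    have hc : s.card ≤ a := by
      simpa using Finset.card_le_card
        (show s ⊆ Finset.range a from fun i hi => Finset.mem_range.2 (ha i hi))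
    rw [Finset.prod_insert has, Finset.card_insert_of_notMem has, Finset.prod_range_succ, mul_comm]
    exact mul_le_mul ih (hd hc) (hd0 _) (Finset.prod_nonneg fun i _ => hd0 i)

theorem sum_mul_rpow_mul_rpow_le {ι : Type*} (s : Finset ι) {c x y : ι → ℝ} {a b : ℝ}
    (ha : 0 < a) (hb : 0 < b) (hab : a + b = 1) (hc : ∀ i, 0 ≤ c i) (hx : ∀ i, 0 ≤ x i)
    (hy : ∀ i, 0 ≤ y i) :
    ∑ i ∈ s, x i ^ a * y i ^ b * c i ≤
      (∑ i ∈ s, x i * c i) ^ a * (∑ i ∈ s, y i * c i) ^ b := by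
  have hpq : (a⁻¹).HolderConjugate b⁻¹ := by
    rw [Real.holderConjugate_iff]
    refine ⟨(one_lt_inv₀ ha).2 (by linarith), by simpa using hab⟩
  have h := Real.inner_le_Lp_mul_Lq_of_nonneg s hpq
    (f := fun i => (x i * c i) ^ a) (g := fun i => (y i * c i) ^ b)
    (fun i _ => Real.rpow_nonneg (mul_nonneg (hx i) (hc i)) _)
    (fun i _ => Real.rpow_nonneg (mul_nonneg (hy i) (hc i)) _)
  have e1 : ∀ i, ((x i * c i) ^ a) ^ a⁻¹ = x i * c i := fun i =>
    Real.rpow_rpow_inv (mul_nonneg (hx i) (hc i)) ha.ne'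
  have e2 : ∀ i, ((y i * c i) ^ b) ^ b⁻¹ = y i * c i := fun i =>
    Real.rpow_rpow_inv (mul_nonneg (hy i) (hc i)) hb.ne'
  simp only [e1, e2, one_div, inv_inv] at h
  refine le_of_eq_of_le (Finset.sum_congr rfl fun i _ => ?_) h
  rw [Real.mul_rpow (hx i) (hc i), Real.mul_rpow (hy i) (hc i)]
  have : c i = c i ^ a * c i ^ b := by
    rw [← Real.rpow_add' (hc i) (by rw [hab]; exact one_ne_zero), hab, Real.rpow_one]
  conv_lhs => rw [this]
  ring

namespace Matrix

/-- The Cauchy–Binet formula, summed over all (not necessarily increasing) index tuples. -/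
theorem factorial_mul_det_mul_diagonal_mul {ι R : Type*} [Fintype ι] [DecidableEq ι] [CommRing R]
    {k : ℕ} (A : Matrix (Fin k) ι R) (D : ι → R) (B : Matrix ι (Fin k) R) :
    (k.factorial : R) * (A * diagonal D * B).det =
      ∑ f : Fin k → ι, (∏ i, D (f i)) *
        ((A.submatrix id f).det * (B.submatrix f id).det) := by
  have h1 : (A * diagonal D * B).det =
      ∑ f : Fin k → ι, (∏ i, A i (f i) * D (f i)) * (B.submatrix f id).det := by
    have e : A * diagonal D * B = fun i => ∑ l, (A i l * D l) • B l := by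
      ext i j
      rw [mul_apply]
      simp [mul_diagonal, Finset.sum_apply]
    rw [e]
    change detRowAlternating.toMultilinearMap (fun i => ∑ l, (A i l * D l) • B l) = _
    rw [MultilinearMap.map_sum]
    refine Finset.sum_congr rfl fun f _ => ?_
    rw [MultilinearMap.map_smul_univ]
    rfl
  -- Reindexing f by τ leaves ∏ D unchanged and multiplies the minor of B by sign τ; summing over
  -- all k! choices of τ assembles the minor of A.
  have h2 : ∀ τ : Equiv.Perm (Fin k), (A * diagonal D * B).det =
      ∑ f : Fin k → ι, (∏ i, D (f i)) *
        ((Equiv.Perm.sign τ * ∏ i, A i (f (τ i))) * (B.submatrix f id).det) := fun τ => by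
    rw [h1, ← Equiv.sum_comp (Equiv.arrowCongr τ.symm (Equiv.refl ι))]
    refine Finset.sum_congr rfl fun f _ => ?_
    have e1 : B.submatrix ((Equiv.arrowCongr τ.symm (Equiv.refl ι)) f) id =
        (B.submatrix f id).submatrix τ id := rfl
    have e2 : ∀ i, (Equiv.arrowCongr τ.symm (Equiv.refl ι)) f i = f (τ i) := fun i => rfl
    rw [e1, det_permute]
    simp only [e2, Finset.prod_mul_distrib]
    rw [Equiv.prod_comp τ fun i => D (f i)]
    ring
  have h3 : (k.factorial : R) * (A * diagonal D * B).det =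
      ∑ _τ : Equiv.Perm (Fin k), (A * diagonal D * B).det := by
    rw [Finset.sum_const, Finset.card_univ, Fintype.card_perm, Fintype.card_fin, nsmul_eq_mul]
  rw [h3, Finset.sum_congr rfl fun τ _ => h2 τ, Finset.sum_comm]
  refine Finset.sum_congr rfl fun f _ => ?_
  rw [← Finset.mul_sum, ← Finset.sum_mul, ← det_transpose (A.submatrix id f), det_apply' (A.submatrix id f)ᵀ]
  rfl

/-- `k!` times the sum over `k`-subsets of the products of the weights `D` times the squared moduli
of the maximal minors of `M`. -/
noncomputable def weightedMinorSum {ι : Type*} [Fintype ι] {k : ℕ} (M : Matrix ι (Fin k) ℂ)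
    (D : ι → ℝ) : ℝ :=
  ∑ f : Fin k → ι, (∏ i, D (f i)) * ‖(M.submatrix f id).det‖ ^ 2

theorem factorial_mul_det_conjTranspose_mul_diagonal_mul {ι : Type*} [Fintype ι] [DecidableEq ι]
    {k : ℕ} (M : Matrix ι (Fin k) ℂ) (D : ι → ℝ) :
    (k.factorial : ℂ) * (Mᴴ * diagonal (fun i => (D i : ℂ)) * M).det =
      (M.weightedMinorSum D : ℂ) := by
  rw [factorial_mul_det_mul_diagonal_mul, weightedMinorSum]
  push_cast
  refine Finset.sum_congr rfl fun f _ => ?_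
  rw [← conjTranspose_submatrix, det_conjTranspose, Complex.star_def, Complex.conj_mul']

theorem weightedMinorSum_nonneg {ι : Type*} [Fintype ι] {k : ℕ} (M : Matrix ι (Fin k) ℂ)
    {D : ι → ℝ} (hD : ∀ i, 0 ≤ D i) : 0 ≤ M.weightedMinorSum D :=
  Finset.sum_nonneg fun _ _ =>
    mul_nonneg (Finset.prod_nonneg fun _ _ => hD _) (by positivity)

/-- Geometric means commute with the products ∏ D (f i), so this is Hölder with the squared minors
as weights. -/
theorem weightedMinorSum_rpow_mul_rpow_le {ι : Type*} [Fintype ι] {k : ℕ}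
    (M : Matrix ι (Fin k) ℂ) {D₁ D₂ : ι → ℝ} {a b : ℝ} (ha : 0 < a) (hb : 0 < b) (hab : a + b = 1)
    (h₁ : ∀ i, 0 ≤ D₁ i) (h₂ : ∀ i, 0 ≤ D₂ i) :
    M.weightedMinorSum (fun i => D₁ i ^ a * D₂ i ^ b) ≤
      M.weightedMinorSum D₁ ^ a * M.weightedMinorSum D₂ ^ b := by
  refine le_of_eq_of_le (Finset.sum_congr rfl fun f _ => ?_)
    (sum_mul_rpow_mul_rpow_le Finset.univ ha hb hab
      (c := fun f : Fin k → ι => ‖(M.submatrix f id).det‖ ^ 2) (fun f => by positivity)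
      (fun f => Finset.prod_nonneg fun i _ => h₁ (f i))
      (fun f => Finset.prod_nonneg fun i _ => h₂ (f i)))
  rw [Finset.prod_mul_distrib, Real.finsetProd_rpow _ _ fun i _ => h₁ (f i),
    Real.finsetProd_rpow _ _ fun i _ => h₂ (f i)]

/-- The squared minors of an isometry sum to k!. Tuples with a repeated index have zero minor, and
the others have weight at most the product of the first k terms of `d`. -/
theorem weightedMinorSum_le_of_conjTranspose_mul_self {n k : ℕ} (M : Matrix (Fin n) (Fin k) ℂ)
    (hM : Mᴴ * M = 1) {d : ℕ → ℝ} (hd : Antitone d) (hd0 : ∀ i, 0 ≤ d i) :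
    M.weightedMinorSum (fun i => d i) ≤ k.factorial * ∏ i ∈ Finset.range k, d i := by
  have h1 : M.weightedMinorSum (fun _ => 1) = k.factorial := by
    have := factorial_mul_det_conjTranspose_mul_diagonal_mul M fun _ => 1
    simp only [Complex.ofReal_one, diagonal_one, Matrix.mul_one, hM, det_one, mul_one] at this
    exact_mod_cast this.symm
  rw [← h1, weightedMinorSum, weightedMinorSum, Finset.sum_mul]
  refine Finset.sum_le_sum fun f _ => ?_
  by_cases hf : Function.Injective f
  · have : ∏ i, d (f i) ≤ ∏ i ∈ Finset.range k, d i := by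
      have hg : Function.Injective fun i => (f i : ℕ) := Fin.val_injective.comp hf
      have := prod_le_prod_range_card_of_antitone hd hd0 (Finset.univ.image fun i => (f i : ℕ))
      rwa [Finset.prod_image fun i _ j _ h => hg h, Finset.card_image_of_injective _ hg,
        Finset.card_univ, Fintype.card_fin] at this
    simp only [Finset.prod_const_one, one_mul]
    rw [mul_comm]
    exact mul_le_mul_of_nonneg_left this (by positivity)
  · obtain ⟨i, j, hij, hne⟩ : ∃ i j, f i = f j ∧ i ≠ j := by
      simpa [Function.Injective] using hf
    rw [det_zero_of_row_eq hne (by ext l; simp [hij])]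
    simp

/-- The spectral theorem with the functional calculus, for the eigenvalues in decreasing order. -/
theorem PosSemidef.exists_antitone_cfc_eq {n : ℕ} {H : Matrix (Fin n) (Fin n) ℂ}
    (hH : H.PosSemidef) :
    ∃ U ∈ unitaryGroup (Fin n) ℂ, ∃ d : ℕ → ℝ, Antitone d ∧ (∀ i, 0 ≤ d i) ∧
      ∀ f : ℝ → ℝ, cfc f H = U * diagonal (fun i : Fin n => (f (d i) : ℂ)) * Uᴴ := by
  obtain ⟨σ, hσ⟩ : ∃ σ : Equiv.Perm (Fin n), Antitone fun i => hH.1.eigenvalues (σ i) :=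
    ⟨Tuple.sort fun i => -hH.1.eigenvalues i, fun i j hij =>
      neg_le_neg_iff.1 (Tuple.monotone_sort (fun i => -hH.1.eigenvalues i) hij)⟩
  set V : Matrix (Fin n) (Fin n) ℂ := hH.1.eigenvectorUnitary.1 with hV
  -- Padding by 0 keeps the sequence decreasing since the eigenvalues are nonnegative.
  set d : ℕ → ℝ := fun i => if hi : i < n then hH.1.eigenvalues (σ ⟨i, hi⟩) else 0 with hd
  have hd0 : ∀ i, 0 ≤ d i := fun i => by
    simp only [hd]
    split_ifs
    exacts [hH.eigenvalues_nonneg _, le_rfl]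
  have hVV : V * Vᴴ = 1 := mem_unitaryGroup_iff.1 hH.1.eigenvectorUnitary.2
  refine ⟨V.submatrix id σ, ?_, d, fun i j hij => ?_, hd0, fun f => ?_⟩
  · rw [mem_unitaryGroup_iff, star_eq_conjTranspose, conjTranspose_submatrix,
      submatrix_mul_equiv, hVV]
    simp
  · by_cases hj : j < n
    · simp only [hd, hj, hij.trans_lt hj, dif_pos]
      exact hσ (by simpa using hij)
    · rw [show d j = 0 by simp [hd, hj]]
      exact hd0 i
  · have e : diagonal (fun i : Fin n => (f (d i) : ℂ)) =
        (diagonal fun i => (f (hH.1.eigenvalues i) : ℂ)).submatrix σ σ := by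
      ext i j
      simp [diagonal_apply, hd]
    rw [hH.1.cfc_eq, IsHermitian.cfc, Unitary.conjStarAlgAut_apply, e, conjTranspose_submatrix,
      submatrix_mul_equiv, submatrix_mul_equiv]
    rfl

/-- Log-convexity of the product of the `k` largest eigenvalues of `Zᴴ D Z` in the weights `D`. -/
theorem prod_range_eigenvalues_le {ι : Type*} [Fintype ι] [DecidableEq ι] {n k : ℕ} (hk : k ≤ n)
    (Z : Matrix ι (Fin n) ℂ) {D₁ D₂ : ι → ℝ} {a b : ℝ} (ha : 0 < a) (hb : 0 < b) (hab : a + b = 1)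
    (h₁ : ∀ i, 0 ≤ D₁ i) (h₂ : ∀ i, 0 ≤ D₂ i)
    {U U₁ U₂ : Matrix (Fin n) (Fin n) ℂ} (hU : U ∈ unitaryGroup (Fin n) ℂ)
    (hU₁ : U₁ ∈ unitaryGroup (Fin n) ℂ) (hU₂ : U₂ ∈ unitaryGroup (Fin n) ℂ) {d d₁ d₂ : ℕ → ℝ}
    (hd₁ : Antitone d₁) (hd₂ : Antitone d₂) (hp₁ : ∀ i, 0 ≤ d₁ i) (hp₂ : ∀ i, 0 ≤ d₂ i)
    (e : Zᴴ * diagonal (fun i => ((D₁ i ^ a * D₂ i ^ b : ℝ) : ℂ)) * Z =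
      U * diagonal (fun i : Fin n => (d i : ℂ)) * Uᴴ)
    (e₁ : Zᴴ * diagonal (fun i => (D₁ i : ℂ)) * Z =
      U₁ * diagonal (fun i : Fin n => (d₁ i : ℂ)) * U₁ᴴ)
    (e₂ : Zᴴ * diagonal (fun i => (D₂ i : ℂ)) * Z =
      U₂ * diagonal (fun i : Fin n => (d₂ i : ℂ)) * U₂ᴴ) :
    ∏ i ∈ Finset.range k, d i ≤
      (∏ i ∈ Finset.range k, d₁ i) ^ a * (∏ i ∈ Finset.range k, d₂ i) ^ b := by
  -- Compression by the first k columns of U gives exactly the first k entries of d for the middle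
  -- operator (`h0`), but only an upper bound for the two outer ones (`key`).
  set W : Matrix (Fin n) (Fin k) ℂ := U.submatrix id (Fin.castLE hk) with hW
  have hUU : Uᴴ * U = 1 := mem_unitaryGroup_iff'.1 hU
  have hUW : Uᴴ * W = (1 : Matrix (Fin n) (Fin n) ℂ).submatrix id (Fin.castLE hk) := by
    rw [← hUU]
    rfl
  have hWU : Wᴴ * U = (1 : Matrix (Fin n) (Fin n) ℂ).submatrix (Fin.castLE hk) id := by
    rw [← hUU]
    rfl
  have hWW : Wᴴ * W = 1 := by
    have : Wᴴ * W = (Uᴴ * U).submatrix (Fin.castLE hk) (Fin.castLE hk) := rfl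
    rw [this, hUU, submatrix_one _ (Fin.castLE_injective hk)]
  have key : ∀ {V : Matrix (Fin n) (Fin n) ℂ} {E : ι → ℝ} {q : ℕ → ℝ},
      V ∈ unitaryGroup (Fin n) ℂ → Antitone q → (∀ i, 0 ≤ q i) →
      Zᴴ * diagonal (fun i => (E i : ℂ)) * Z = V * diagonal (fun i : Fin n => (q i : ℂ)) * Vᴴ →
      (Z * W).weightedMinorSum E ≤ k.factorial * ∏ i ∈ Finset.range k, q i := by
    intro V E q hV hq hq0 he
    have hiso : (Vᴴ * W)ᴴ * (Vᴴ * W) = 1 := by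
      have hVV : V * Vᴴ = 1 := mem_unitaryGroup_iff.1 hV
      rw [conjTranspose_mul, conjTranspose_conjTranspose, Matrix.mul_assoc, ← Matrix.mul_assoc V,
        hVV, Matrix.one_mul, hWW]
    refine le_of_eq_of_le ?_ (weightedMinorSum_le_of_conjTranspose_mul_self _ hiso hq hq0)
    have h1 := factorial_mul_det_conjTranspose_mul_diagonal_mul (Z * W) E
    have h2 := factorial_mul_det_conjTranspose_mul_diagonal_mul (Vᴴ * W) (fun i : Fin n => q i)
    have h3 : (Z * W)ᴴ * diagonal (fun i => (E i : ℂ)) * (Z * W) =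
        (Vᴴ * W)ᴴ * diagonal (fun i : Fin n => (q i : ℂ)) * (Vᴴ * W) := by
      calc _ = Wᴴ * (Zᴴ * diagonal (fun i => (E i : ℂ)) * Z) * W := by
            simp only [conjTranspose_mul, Matrix.mul_assoc]
        _ = _ := by
            rw [he]
            simp only [conjTranspose_mul, conjTranspose_conjTranspose, Matrix.mul_assoc]
    rw [h3, h2] at h1
    exact_mod_cast h1.symm
  have h0 : (k.factorial : ℝ) * ∏ i ∈ Finset.range k, d i =
      (Z * W).weightedMinorSum fun i => D₁ i ^ a * D₂ i ^ b := by
    have h1 := factorial_mul_det_conjTranspose_mul_diagonal_mul (Z * W)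
      fun i => D₁ i ^ a * D₂ i ^ b
    have h3 : (Z * W)ᴴ * diagonal (fun i => ((D₁ i ^ a * D₂ i ^ b : ℝ) : ℂ)) * (Z * W) =
        diagonal fun i : Fin k => (d i : ℂ) := by
      calc _ = Wᴴ * (Zᴴ * diagonal (fun i => ((D₁ i ^ a * D₂ i ^ b : ℝ) : ℂ)) * Z) * W := by
            simp only [conjTranspose_mul, Matrix.mul_assoc]
        _ = (Wᴴ * U) * diagonal (fun i : Fin n => (d i : ℂ)) * (Uᴴ * W) := by
            rw [e]
            simp only [Matrix.mul_assoc]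
        _ = _ := by
            rw [hUW, hWU]
            ext i j
            simp [mul_apply, diagonal_apply, one_apply, (Fin.castLE_injective hk).eq_iff]
            rcases eq_or_ne i j with rfl | hij <;> simp [*]
    rw [h3, det_diagonal] at h1
    rw [← Fin.prod_univ_eq_prod_range]
    exact_mod_cast h1
  have hf : (0 : ℝ) < k.factorial := by exact_mod_cast k.factorial_pos
  have hq₁ : 0 ≤ ∏ i ∈ Finset.range k, d₁ i := Finset.prod_nonneg fun i _ => hp₁ i
  have hq₂ : 0 ≤ ∏ i ∈ Finset.range k, d₂ i := Finset.prod_nonneg fun i _ => hp₂ i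
  refine le_of_mul_le_mul_left ?_ hf
  calc (k.factorial : ℝ) * ∏ i ∈ Finset.range k, d i
      ≤ (Z * W).weightedMinorSum D₁ ^ a * (Z * W).weightedMinorSum D₂ ^ b := by
        rw [h0]
        exact weightedMinorSum_rpow_mul_rpow_le _ ha hb hab h₁ h₂
    _ ≤ (k.factorial * ∏ i ∈ Finset.range k, d₁ i) ^ a *
          (k.factorial * ∏ i ∈ Finset.range k, d₂ i) ^ b :=
        mul_le_mul
          (Real.rpow_le_rpow (weightedMinorSum_nonneg _ h₁) (key hU₁ hd₁ hp₁ e₁) ha.le)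
          (Real.rpow_le_rpow (weightedMinorSum_nonneg _ h₂) (key hU₂ hd₂ hp₂ e₂) hb.le)
          (Real.rpow_nonneg (weightedMinorSum_nonneg _ h₂) _) (by positivity)
    _ = _ := by
        rw [Real.mul_rpow hf.le hq₁, Real.mul_rpow hf.le hq₂]
        have : (k.factorial : ℝ) = (k.factorial : ℝ) ^ a * (k.factorial : ℝ) ^ b := by
          rw [← Real.rpow_add hf, hab, Real.rpow_one]
        conv_rhs => rw [this]
        ring

end Matrix

/-! ### Hölder inequality for symmetric norms. -/

/-- The choice r = S₂ / S₁ makes the weighted sum equal to the geometric mean; shifting both by ε →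
0 covers vanishing values. -/
theorem le_rpow_mul_rpow_of_forall_le {T S₁ S₂ a b : ℝ} (h₁ : 0 ≤ S₁) (h₂ : 0 ≤ S₂) (ha : 0 ≤ a)
    (hb : 0 ≤ b) (hab : a + b = 1)
    (h : ∀ r : ℝ, 0 < r → T ≤ a * r ^ b * S₁ + b * r ^ (-a) * S₂) : T ≤ S₁ ^ a * S₂ ^ b := by
  have key : ∀ ε : ℝ, 0 < ε → T ≤ (S₁ + ε) ^ a * (S₂ + ε) ^ b := fun ε hε => by
    have hA : 0 < S₁ + ε := by linarith
    have hB : 0 < S₂ + ε := by linarith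
    have hr : 0 < (S₂ + ε) / (S₁ + ε) := div_pos hB hA
    set A := S₁ + ε
    set B := S₂ + ε
    have e1 : (B / A) ^ b * A = A ^ a * B ^ b := by
      have : A = A ^ a * A ^ b := by rw [← Real.rpow_add hA, hab, Real.rpow_one]
      conv_lhs => enter [2]; rw [this]
      rw [Real.div_rpow hB.le hA.le]
      have := (Real.rpow_pos_of_pos hA b).ne'
      field_simp
    have e2 : (B / A) ^ (-a) * B = A ^ a * B ^ b := by
      have : B = B ^ a * B ^ b := by rw [← Real.rpow_add hB, hab, Real.rpow_one]
      conv_lhs => enter [2]; rw [this]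
      rw [Real.rpow_neg hr.le, Real.div_rpow hB.le hA.le]
      have := (Real.rpow_pos_of_pos hB a).ne'
      have := (Real.rpow_pos_of_pos hA a).ne'
      field_simp
    calc T ≤ a * (B / A) ^ b * S₁ + b * (B / A) ^ (-a) * S₂ := h _ hr
      _ ≤ a * (B / A) ^ b * A + b * (B / A) ^ (-a) * B := by
        have : S₁ ≤ A := by simp only [A]; linarith
        have : S₂ ≤ B := by simp only [B]; linarith
        gcongr
      _ = A ^ a * B ^ b := by
        rw [mul_assoc, mul_assoc, e1, e2, ← add_mul, hab, one_mul]
  have hc : Filter.Tendsto (fun ε : ℝ => (S₁ + ε) ^ a * (S₂ + ε) ^ b)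
      (nhdsWithin 0 (Set.Ioi 0)) (nhds (S₁ ^ a * S₂ ^ b)) := by
    have : Continuous fun ε : ℝ => (S₁ + ε) ^ a * (S₂ + ε) ^ b :=
      ((continuous_const.add continuous_id).rpow_const fun _ => Or.inr ha).mul
        ((continuous_const.add continuous_id).rpow_const fun _ => Or.inr hb)
    have := (this.tendsto 0).mono_left (nhdsWithin_le_nhds (s := Set.Ioi 0))
    simpa using this
  exact ge_of_tendsto hc (Filter.eventually_of_mem self_mem_nhdsWithin key)

/-- A Hölder inequality for symmetric norms, under weak log-majorization. -/
theorem IsSymmetricNorm.realDiagonal_le_rpow_mul_rpow {n : ℕ}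
    {N : Seminorm ℂ (Matrix (Fin n) (Fin n) ℂ)} (hN : IsSymmetricNorm N) {x y z : ℕ → ℝ}
    {a b : ℝ} (ha : 0 ≤ a) (hb : 0 ≤ b) (hab : a + b = 1)
    (hx : Antitone x) (hx0 : ∀ i, 0 ≤ x i) (hy0 : ∀ i, 0 ≤ y i) (hz0 : ∀ i, 0 ≤ z i)
    (h : ∀ k ≤ n, ∏ i ∈ Finset.range k, x i ≤ ∏ i ∈ Finset.range k, y i ^ a * z i ^ b) :
    N.realDiagonal (fun i => x i) ≤
      N.realDiagonal (fun i => y i) ^ a * N.realDiagonal (fun i => z i) ^ b := by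
  refine le_rpow_mul_rpow_of_forall_le (apply_nonneg _ _) (apply_nonneg _ _) ha hb hab
    fun r hr => ?_
  have hc₁ : 0 ≤ a * r ^ b := by positivity
  have hc₂ : 0 ≤ b * r ^ (-a) := by positivity
  -- Young for r^b y and r^(-a) z, whose weighted geometric mean is free of r. The bound is linear
  -- in y and z, so the triangle inequality applies.
  have hyoung : ∀ i, y i ^ a * z i ^ b ≤ a * r ^ b * y i + b * r ^ (-a) * z i := fun i => by
    have := Real.geom_mean_le_arith_mean2_weighted ha hb
      (mul_nonneg (Real.rpow_nonneg hr.le b) (hy0 i))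
      (mul_nonneg (Real.rpow_nonneg hr.le (-a)) (hz0 i)) hab
    rw [Real.mul_rpow (Real.rpow_nonneg hr.le _) (hy0 i),
      Real.mul_rpow (Real.rpow_nonneg hr.le _) (hz0 i), ← Real.rpow_mul hr.le,
      ← Real.rpow_mul hr.le] at this
    have e : r ^ (b * a) * r ^ (-a * b) = 1 := by
      rw [← Real.rpow_add hr, show b * a + -a * b = 0 by ring, Real.rpow_zero]
    calc y i ^ a * z i ^ b = (r ^ (b * a) * r ^ (-a * b)) * (y i ^ a * z i ^ b) := by
          rw [e, one_mul]
      _ = r ^ (b * a) * y i ^ a * (r ^ (-a * b) * z i ^ b) := by ring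
      _ ≤ _ := this
      _ = _ := by ring
  calc N.realDiagonal (fun i => x i)
      ≤ N.realDiagonal (fun i => a * r ^ b * y i + b * r ^ (-a) * z i) :=
        hN.realDiagonal_le_of_prod_range_le
          (y := fun i => a * r ^ b * y i + b * r ^ (-a) * z i) hx hx0
          (fun i => add_nonneg (mul_nonneg hc₁ (hy0 i)) (mul_nonneg hc₂ (hz0 i)))
          fun k hk => (h k hk).trans (Finset.prod_le_prod
            (fun i _ => mul_nonneg (Real.rpow_nonneg (hy0 i) _) (Real.rpow_nonneg (hz0 i) _))
            fun i _ => hyoung i)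
    _ = N.realDiagonal ((a * r ^ b) • (fun i : Fin n => y i) +
          (b * r ^ (-a)) • (fun i : Fin n => z i)) := rfl
    _ ≤ _ := by
      refine (map_add_le_add _ _ _).trans ?_
      rw [map_smul_eq_mul, map_smul_eq_mul, Real.norm_of_nonneg hc₁, Real.norm_of_nonneg hc₂]

theorem IsSymmetricNorm.apply_unitary_conj_diagonal {n : ℕ}
    {N : Seminorm ℂ (Matrix (Fin n) (Fin n) ℂ)} (hN : IsSymmetricNorm N)
    {U : Matrix (Fin n) (Fin n) ℂ} (hU : U ∈ Matrix.unitaryGroup (Fin n) ℂ) (d : Fin n → ℝ) :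
    N (U * Matrix.diagonal (fun i => (d i : ℂ)) * U.conjTranspose) = N.realDiagonal d :=
  hN.unitary_mul_mul U hU _ (Unitary.star_mem hU) _

/-! ### Positive maps as compressions, and part (i). -/

open Matrix in
/-- Positive linear maps on the functional calculus of a positive semidefinite matrix are
compressions of diagonal matrices. -/
theorem Matrix.PosSemidef.exists_map_cfc_eq {m n : ℕ} {A : Matrix (Fin m) (Fin m) ℂ}
    (hA : A.PosSemidef) (Φ : Matrix (Fin m) (Fin m) ℂ →ₚ[ℂ] Matrix (Fin n) (Fin n) ℂ) :
    ∃ (Z : Matrix (Fin m × Fin n) (Fin n) ℂ) (l : Fin m × Fin n → ℝ), (∀ i, 0 ≤ l i) ∧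
      ∀ f : ℝ → ℝ, Φ (cfc f A) = Zᴴ * diagonal (fun i => (f (l i) : ℂ)) * Z := by
  obtain ⟨U, -, d, -, hd0, hf⟩ := hA.exists_antitone_cfc_eq
  have hΦ : ∀ i : Fin m, (Φ (U * single i i 1 * Uᴴ)).PosSemidef := fun i => by
    have : (U * single i i 1 * Uᴴ).PosSemidef := by
      rw [← diagonal_single]
      refine PosSemidef.mul_mul_conjTranspose_same (PosSemidef.diagonal fun j => ?_) U
      by_cases h : j = i
      · subst h; simp
      · simp [h]
    have := map_nonneg Φ this.nonneg
    rwa [← nonneg_iff_posSemidef]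
  choose C hC using fun i => CStarAlgebra.nonneg_iff_eq_star_mul_self.1 (hΦ i).nonneg
  -- Z stacks the factors Cᵢ, where Cᵢᴴ Cᵢ is the image of the i-th spectral projection; each
  -- eigenvalue is repeated along its block.
  refine ⟨of fun ia b => C ia.1 ia.2 b, fun ia => d ia.1, fun _ => hd0 _, fun f => ?_⟩
  have e : U * diagonal (fun i : Fin m => (f (d i) : ℂ)) * Uᴴ =
      ∑ i : Fin m, (f (d i) : ℂ) • (U * single i i 1 * Uᴴ) := by
    have : diagonal (fun i : Fin m => (f (d i) : ℂ)) =
        ∑ i : Fin m, (f (d i) : ℂ) • single i i (1 : ℂ) := by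
      ext i j
      rcases eq_or_ne i j with rfl | h
      · simp [Matrix.sum_apply, single_apply]
      · simp only [diagonal_apply_ne _ h, Matrix.sum_apply, smul_apply]
        exact (Finset.sum_eq_zero fun l _ => by
          rw [single_apply_of_ne _ _ _ _ _ (by rintro ⟨rfl, rfl⟩; exact h rfl), smul_zero]).symm
    rw [this, Matrix.mul_sum, Matrix.sum_mul]
    simp only [Matrix.mul_smul, Matrix.smul_mul]
  rw [hf, e, map_sum]
  simp only [map_smul, hC]
  ext a b
  rw [mul_apply]
  simp only [mul_diagonal]
  simp only [Fintype.sum_prod_type, Matrix.sum_apply, smul_apply, mul_apply,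
    star_eq_conjTranspose, conjTranspose_apply, of_apply, smul_eq_mul, Finset.mul_sum]
  refine Finset.sum_congr rfl fun i _ => Finset.sum_congr rfl fun j _ => by ring

/-- The power function of `psdPow`. -/
noncomputable def genPow (s x : ℝ) : ℝ := if x = 0 then 0 else x ^ s

theorem psdPow_eq_cfc_genPow {n : ℕ} (A : Matrix (Fin n) (Fin n) ℂ) (s : ℝ) :
    psdPow A s = cfc (genPow s) A := rfl

theorem genPow_nonneg (s : ℝ) {x : ℝ} (hx : 0 ≤ x) : 0 ≤ genPow s x := by
  unfold genPow
  split_ifs <;> positivity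

theorem genPow_of_pos {s : ℝ} (hs : 0 < s) (x : ℝ) : genPow s x = x ^ s := by
  unfold genPow
  split_ifs with h
  · rw [h, Real.zero_rpow hs.ne']
  · rfl

/-- The condition a ≠ 0 excludes 0 ^ 0 = 1 at x = 0. -/
theorem genPow_add_mul (s t : ℝ) {a b x : ℝ} (ha : a ≠ 0) (hx : 0 ≤ x) :
    genPow (a * s + b * t) x = genPow s x ^ a * genPow t x ^ b := by
  unfold genPow
  split_ifs with h
  · rw [Real.zero_rpow ha, zero_mul]
  · have hx' := hx.lt_of_ne' h
    rw [← Real.rpow_mul hx, ← Real.rpow_mul hx, ← Real.rpow_add hx', mul_comm s, mul_comm t]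

open Matrix in
theorem logConvexOn_norm_psdPow {m n : ℕ} {A : Matrix (Fin m) (Fin m) ℂ} (hA : A.PosSemidef)
    (Φ : Matrix (Fin m) (Fin m) ℂ →ₚ[ℂ] Matrix (Fin n) (Fin n) ℂ)
    {N : Seminorm ℂ (Matrix (Fin n) (Fin n) ℂ)} (hN : IsSymmetricNorm N) {α : ℝ} (hα : 0 < α) :
    LogConvexOn (Set.Ioi (0 : ℝ) ×ˢ (Set.univ : Set ℝ))
      (fun x : ℝ × ℝ => N (psdPow (Φ (psdPow A (x.2 / x.1))) (α * x.1))) := by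
  refine ⟨(convex_Ioi 0).prod convex_univ, fun x _ => apply_nonneg N _, ?_⟩
  rintro ⟨p, t⟩ ⟨hp, -⟩ ⟨q, s⟩ ⟨hq, -⟩ a b ha hb hab
  rcases ha.eq_or_lt with rfl | ha'
  · obtain rfl : b = 1 := by linarith
    simp
  rcases hb.eq_or_lt with rfl | hb'
  · obtain rfl : a = 1 := by linarith
    simp
  replace hp : 0 < p := hp
  replace hq : 0 < q := hq
  simp only [Prod.smul_mk, Prod.mk_add_mk, smul_eq_mul]
  set r := a * p + b * q with hr
  have hr0 : 0 < r := by positivity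
  -- Although (p, t) ↦ t / p is not affine, the middle exponent is the convex combination of t / p
  -- and s / q with weights c₁, c₂. Raising to the power α r later turns these into α p a and α q b.
  set c₁ := a * p / r with hc₁
  set c₂ := b * q / r with hc₂
  have hc₁0 : 0 < c₁ := by positivity
  have hc₂0 : 0 < c₂ := by positivity
  have hc : c₁ + c₂ = 1 := by rw [hc₁, hc₂, ← add_div, ← hr, div_self hr0.ne']
  have hexp : (a * t + b * s) / r = c₁ * (t / p) + c₂ * (s / q) := by
    rw [hc₁, hc₂]
    field_simp
  obtain ⟨Z, l, hl0, hZ⟩ := hA.exists_map_cfc_eq Φ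
  have hpos : ∀ u, (Φ (psdPow A u)).PosSemidef := fun u => by
    rw [psdPow_eq_cfc_genPow, hZ]
    refine PosSemidef.conjTranspose_mul_mul_same (PosSemidef.diagonal fun i => ?_) Z
    change (0 : ℂ) ≤ (genPow u (l i) : ℂ)
    exact_mod_cast genPow_nonneg u (hl0 i)
  have hspec : ∀ u, ∃ U ∈ unitaryGroup (Fin n) ℂ, ∃ d : ℕ → ℝ, Antitone d ∧ (∀ i, 0 ≤ d i) ∧
      (Zᴴ * diagonal (fun i => (genPow u (l i) : ℂ)) * Z =
        U * diagonal (fun i : Fin n => (d i : ℂ)) * Uᴴ) ∧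
      ∀ v, 0 < v → N (psdPow (Φ (psdPow A u)) v) = N.realDiagonal fun i => d i ^ v := by
    intro u
    obtain ⟨U, hU, d, hd, hd0, hf⟩ := (hpos u).exists_antitone_cfc_eq
    refine ⟨U, hU, d, hd, hd0, ?_, fun v hv => ?_⟩
    · rw [← hZ, ← psdPow_eq_cfc_genPow, ← hf fun x => x]
      exact (cfc_id' ℝ _ (hpos u).1.isSelfAdjoint).symm
    · rw [psdPow_eq_cfc_genPow (Φ _), hf, hN.apply_unitary_conj_diagonal hU fun i => genPow v (d i)]
      simp only [genPow_of_pos hv]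
  obtain ⟨U, hU, d, hd, hd0, e, hNd⟩ := hspec ((a * t + b * s) / r)
  obtain ⟨U₁, hU₁, d₁, hd₁, hd₁0, e₁, hNd₁⟩ := hspec (t / p)
  obtain ⟨U₂, hU₂, d₂, hd₂, hd₂0, e₂, hNd₂⟩ := hspec (s / q)
  rw [hNd _ (by positivity), hNd₁ _ (by positivity), hNd₂ _ (by positivity)]
  refine hN.realDiagonal_le_rpow_mul_rpow (x := fun i => d i ^ (α * r))
    (y := fun i => d₁ i ^ (α * p)) (z := fun i => d₂ i ^ (α * q)) ha hb hab
    (fun i j hij => Real.rpow_le_rpow (hd0 j) (hd hij) (by positivity))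
    (fun i => Real.rpow_nonneg (hd0 i) _) (fun i => Real.rpow_nonneg (hd₁0 i) _)
    (fun i => Real.rpow_nonneg (hd₂0 i) _) fun k hk => ?_
  have hprod := prod_range_eigenvalues_le hk Z (D₁ := fun i => genPow (t / p) (l i))
    (D₂ := fun i => genPow (s / q) (l i)) hc₁0 hc₂0 hc (fun i => genPow_nonneg _ (hl0 i))
    (fun i => genPow_nonneg _ (hl0 i)) hU hU₁ hU₂ hd₁ hd₂ hd₁0 hd₂0
    (by
      rw [← e, hexp]
      simp only [genPow_add_mul _ _ hc₁0.ne' (hl0 _)]) e₁ e₂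
  have hP₁ : 0 ≤ ∏ i ∈ Finset.range k, d₁ i := Finset.prod_nonneg fun i _ => hd₁0 i
  have hP₂ : 0 ≤ ∏ i ∈ Finset.range k, d₂ i := Finset.prod_nonneg fun i _ => hd₂0 i
  have hc₁r : c₁ * (α * r) = α * p * a := by
    rw [hc₁]
    field_simp
  have hc₂r : c₂ * (α * r) = α * q * b := by
    rw [hc₂]
    field_simp
  calc ∏ i ∈ Finset.range k, d i ^ (α * r)
      = (∏ i ∈ Finset.range k, d i) ^ (α * r) := Real.finsetProd_rpow _ _ (fun i _ => hd0 i) _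
    _ ≤ ((∏ i ∈ Finset.range k, d₁ i) ^ c₁ * (∏ i ∈ Finset.range k, d₂ i) ^ c₂) ^ (α * r) :=
      Real.rpow_le_rpow (Finset.prod_nonneg fun i _ => hd0 i) hprod (by positivity)
    _ = (∏ i ∈ Finset.range k, d₁ i) ^ (α * p * a) *
          (∏ i ∈ Finset.range k, d₂ i) ^ (α * q * b) := by
      rw [Real.mul_rpow (Real.rpow_nonneg hP₁ _) (Real.rpow_nonneg hP₂ _), ← Real.rpow_mul hP₁,
        ← Real.rpow_mul hP₂, hc₁r, hc₂r]
    _ = ∏ i ∈ Finset.range k, (d₁ i ^ (α * p)) ^ a * (d₂ i ^ (α * q)) ^ b := by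
      rw [Finset.prod_mul_distrib, ← Real.finsetProd_rpow _ _ fun i _ => hd₁0 i,
        ← Real.finsetProd_rpow _ _ fun i _ => hd₂0 i]
      simp only [Real.rpow_mul (hd₁0 _), Real.rpow_mul (hd₂0 _)]

/-! ### Part (ii): commutative *-algebras and complete positivity. -/

section Commutative

open Matrix

/-- A jointly injective finite family of characters yields an expansion in projections. -/
theorem exists_projections_of_characters {A ι : Type*} [NonUnitalRing A] [Module ℂ A] [StarRing A]
    [Fintype ι] (χ : ι → A →⋆ₙₐ[ℂ] ℂ)
    (hχ : ∀ X Y, (∀ i, χ i X = χ i Y) → X = Y) :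
    ∃ (E : ι → A) (c : ι → ℝ), (∀ i, 0 ≤ c i) ∧ (∀ i, E i = star (E i) * E i) ∧
      ∀ X, X = ∑ i, ((c i : ℂ) * χ i X) • E i := by
  classical
  -- Multiplying by v - χⱼ(v), written without a unit, kills χⱼ and keeps χᵢ nonzero.
  have sep : ∀ (i : ι) (X₀ : A), χ i X₀ ≠ 0 → ∀ S : Finset ι,
      (∀ j ∈ S, ∃ X, χ i X ≠ χ j X) → ∃ e, χ i e ≠ 0 ∧ ∀ j ∈ S, χ j e = 0 := by
    intro i X₀ h₀ S
    induction S using Finset.induction_on with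
    | empty => exact fun _ => ⟨X₀, h₀, by simp⟩
    | insert j S _ ih =>
      intro hS
      obtain ⟨e, he, heS⟩ := ih fun l hl => hS l (Finset.mem_insert_of_mem hl)
      obtain ⟨v, hv⟩ := hS j (Finset.mem_insert_self j S)
      refine ⟨e * v - χ j v • e, ?_, fun l hl => ?_⟩
      · rw [map_sub, map_mul, map_smul, smul_eq_mul, mul_comm, ← sub_mul]
        exact mul_ne_zero (sub_ne_zero.2 hv) he
      · rw [map_sub, map_mul, map_smul, smul_eq_mul]
        rcases Finset.mem_insert.1 hl with rfl | hl
        · ring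
        · rw [heS l hl]
          ring
  have hE : ∀ i, ∃ e, ∀ j, χ j e = if χ i = χ j ∧ χ i ≠ 0 then 1 else 0 := by
    intro i
    by_cases h : χ i = 0
    · exact ⟨0, fun j => by simp [h]⟩
    obtain ⟨X₀, h₀⟩ := DFunLike.ne_iff.1 h
    obtain ⟨e, he, heS⟩ := sep i X₀ h₀ (Finset.univ.filter fun j => χ i ≠ χ j)
      fun j hj => DFunLike.ne_iff.1 (Finset.mem_filter.1 hj).2
    refine ⟨(χ i e)⁻¹ • e, fun j => ?_⟩
    rw [map_smul, smul_eq_mul]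
    by_cases hj : χ i = χ j
    · rw [if_pos ⟨hj, h⟩, ← hj, inv_mul_cancel₀ he]
    · rw [if_neg fun hc => hj hc.1, heS j (by simpa using hj), mul_zero]
  choose E hE using hE
  -- Characters may repeat in the family; dividing by the multiplicity makes each distinct one count
  -- once.
  refine ⟨E, fun i => ((Finset.univ.filter fun j => χ i = χ j).card : ℝ)⁻¹,
    fun i => by positivity, fun i => hχ _ _ fun j => ?_, fun X => hχ _ _ fun j => ?_⟩
  · rw [map_mul, map_star, hE]
    split_ifs <;> simp
  · rw [map_sum]
    simp only [map_smul, hE, smul_eq_mul]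
    by_cases h : χ j = 0
    · rw [show χ j X = 0 by rw [h]; rfl, Finset.sum_eq_zero]
      intro i _
      rw [if_neg, mul_zero]
      rintro ⟨h1, h2⟩
      exact h2 (h1.trans h)
    · have hterm : ∀ i, (((((Finset.univ.filter fun l => χ i = χ l).card : ℝ)⁻¹ : ℝ) : ℂ) * χ i X) *
          (if χ i = χ j ∧ χ i ≠ 0 then 1 else 0) =
          if χ j = χ i then ((Finset.univ.filter fun l => χ j = χ l).card : ℂ)⁻¹ * χ j X else 0 := by
        intro i
        by_cases hij : χ j = χ i
        · rw [if_pos ⟨hij.symm, hij ▸ h⟩, if_pos hij, hij]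
          push_cast
          ring
        · rw [if_neg fun hc => hij hc.1.symm, if_neg hij, mul_zero]
      rw [Finset.sum_congr rfl fun i _ => hterm i, ← Finset.sum_filter, Finset.sum_const,
        nsmul_eq_mul, ← mul_assoc, mul_inv_cancel₀, one_mul]
      exact Nat.cast_ne_zero.2 (Finset.card_ne_zero.2 ⟨j, by simp⟩)

variable {m n : ℕ} {𝒜 : NonUnitalStarSubalgebra ℂ (Matrix (Fin m) (Fin m) ℂ)}

theorem star_dotProduct_mulVec_of_mulVec_eq {X : Matrix (Fin m) (Fin m) ℂ} {u : Fin m → ℂ} {c : ℂ}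
    (h : X *ᵥ u = c • u) : star u ⬝ᵥ (X *ᵥ u) = c * (star u ⬝ᵥ u) := by
  rw [h, dotProduct_smul, smul_eq_mul]

/-- A joint eigenvector of a `*`-algebra of matrices defines a character. -/
theorem exists_character_of_eigenvector {u : Fin m → ℂ} (hu : u ≠ 0)
    (h : ∀ X : 𝒜, ∃ c : ℂ, (X : Matrix (Fin m) (Fin m) ℂ) *ᵥ u = c • u) :
    ∃ χ : 𝒜 →⋆ₙₐ[ℂ] ℂ, ∀ X : 𝒜, (X : Matrix (Fin m) (Fin m) ℂ) *ᵥ u = χ X • u := by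
  choose c hc using h
  have inj : ∀ {a b : ℂ}, a • u = b • u → a = b := fun hab => smul_left_injective ℂ hu hab
  refine ⟨{ toFun := c, map_smul' := ?_, map_zero' := ?_, map_add' := ?_, map_mul' := ?_,
            map_star' := ?_ }, hc⟩
  · intro a X
    refine inj ?_
    rw [← hc, NonUnitalStarSubalgebra.coe_smul, smul_mulVec, hc, smul_smul]
    rfl
  · refine inj ?_
    rw [← hc]
    simp
  · intro X Y
    refine inj ?_
    rw [← hc, NonUnitalStarSubalgebra.coe_add, add_mulVec, hc, hc, add_smul]
  · intro X Y
    refine inj ?_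
    rw [← hc, NonUnitalStarSubalgebra.coe_mul, ← mulVec_mulVec, hc, mulVec_smul, hc, smul_smul,
      mul_comm]
  · intro X
    have hpos : star u ⬝ᵥ u ≠ 0 := fun h0 => hu (dotProduct_star_self_eq_zero.1 h0)
    have h1 := star_dotProduct_mulVec_of_mulVec_eq (hc (star X))
    have h2 := star_dotProduct_mulVec_of_mulVec_eq (hc X)
    refine mul_right_cancel₀ hpos (h1.symm.trans ?_)
    have h3 : star (star u ⬝ᵥ ((X : Matrix (Fin m) (Fin m) ℂ) *ᵥ u)) =
        star u ⬝ᵥ ((X : Matrix (Fin m) (Fin m) ℂ)ᴴ *ᵥ u) := by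
      rw [← star_dotProduct_star, star_star, star_mulVec, ← dotProduct_mulVec]
    have h4 : star (star u ⬝ᵥ u) = star u ⬝ᵥ u := by rw [← star_dotProduct_star, star_star]
    rw [h2, star_mul', h4] at h3
    exact h3.symm

/-- The self-adjoint elements are commuting symmetric operators, hence jointly diagonalizable; real
and imaginary parts give the rest. -/
theorem span_jointEigenvectors_eq_top (hcomm : ∀ X ∈ 𝒜, ∀ Y ∈ 𝒜, X * Y = Y * X) :
    Submodule.span ℂ {u : EuclideanSpace ℂ (Fin m) | u ≠ 0 ∧
      ∀ X : 𝒜, ∃ c : ℂ, (X : Matrix (Fin m) (Fin m) ℂ) *ᵥ u.ofLp = c • u.ofLp} = ⊤ := by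
  have htop := LinearMap.IsSymmetric.iSup_iInf_eq_top_of_commute
    (T := fun X : selfAdjoint 𝒜 => toEuclideanLin ((X : 𝒜) : Matrix (Fin m) (Fin m) ℂ))
    (fun X => isSymmetric_toEuclideanLin_iff.2 (congrArg Subtype.val X.2))
    (fun X Y _ => by
      refine LinearMap.ext fun v => ?_
      refine (WithLp.ofLp_injective 2) ?_
      simp only [Module.End.mul_apply, toLpLin_apply, mulVec_mulVec]
      rw [hcomm _ X.1.2 _ Y.1.2])
  rw [eq_top_iff, ← htop]
  refine iSup_le fun χ v hv => ?_
  rcases eq_or_ne v 0 with rfl | hv0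
  · exact Submodule.zero_mem _
  refine Submodule.subset_span ⟨hv0, fun X => ?_⟩
  have hsa : ∀ Y : selfAdjoint 𝒜,
      ((Y : 𝒜) : Matrix (Fin m) (Fin m) ℂ) *ᵥ v.ofLp = χ Y • v.ofLp := fun Y => by
    have := Module.End.mem_eigenspace_iff.1 ((Submodule.mem_iInf _).1 hv Y)
    exact congrArg WithLp.ofLp this
  refine ⟨χ (realPart X) + Complex.I * χ (imaginaryPart X), ?_⟩
  conv_lhs => rw [← realPart_add_I_smul_imaginaryPart X]
  rw [NonUnitalStarSubalgebra.coe_add, NonUnitalStarSubalgebra.coe_smul, add_mulVec, smul_mulVec,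
    hsa, hsa, add_smul, mul_smul]

theorem exists_eigenvector_characters (hcomm : ∀ X ∈ 𝒜, ∀ Y ∈ 𝒜, X * Y = Y * X) :
    ∃ (ι : Type) (_ : Fintype ι) (u : ι → Fin m → ℂ) (χ : ι → 𝒜 →⋆ₙₐ[ℂ] ℂ), (∀ i, u i ≠ 0) ∧
      (∀ i (X : 𝒜), (X : Matrix (Fin m) (Fin m) ℂ) *ᵥ u i = χ i X • u i) ∧
      ∀ X Y, (∀ i, χ i X = χ i Y) → X = Y := by
  obtain ⟨b, hbs, hspan, hli⟩ := exists_linearIndependent ℂ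
    {u : EuclideanSpace ℂ (Fin m) | u ≠ 0 ∧
      ∀ X : 𝒜, ∃ c : ℂ, (X : Matrix (Fin m) (Fin m) ℂ) *ᵥ u.ofLp = c • u.ofLp}
  rw [span_jointEigenvectors_eq_top hcomm] at hspan
  have hu : ∀ i : b, i.1.ofLp ≠ 0 := fun i h0 => (hbs i.2).1 (WithLp.ofLp_injective 2 h0)
  choose χ hχ using fun i : b => exists_character_of_eigenvector (hu i) (hbs i.2).2
  refine ⟨b, hli.setFinite.fintype, fun i => i.1.ofLp, χ, hu, hχ, fun X Y h => ?_⟩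
  have : toEuclideanLin (X : Matrix (Fin m) (Fin m) ℂ) = toEuclideanLin (Y : Matrix _ _ ℂ) := by
    refine LinearMap.ext_on hspan fun v hv => WithLp.ofLp_injective 2 ?_
    have h1 := hχ ⟨v, hv⟩ X
    rw [h, ← hχ ⟨v, hv⟩ Y] at h1
    exact h1
  exact Subtype.ext (toEuclideanLin.injective this)

/-- Compressing the block matrix by I ⊗ u yields ‖u‖² [χ(X_ab)]. -/
theorem posSemidef_map_character {k : ℕ} {X : Matrix (Fin k) (Fin k) 𝒜}
    (hX : (Matrix.comp _ _ _ _ ℂ (X.map fun Y => (Y : Matrix (Fin m) (Fin m) ℂ))).PosSemidef)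
    {u : Fin m → ℂ} (hu : u ≠ 0) {χ : 𝒜 → ℂ}
    (hχ : ∀ X : 𝒜, (X : Matrix (Fin m) (Fin m) ℂ) *ᵥ u = χ X • u) :
    (X.map χ).PosSemidef := by
  set B : Matrix (Fin k × Fin m) (Fin k) ℂ := of fun a b => if a.1 = b then u a.2 else 0 with hB
  have h1 := hX.conjTranspose_mul_mul_same B
  have hpos : 0 < star u ⬝ᵥ u := dotProduct_star_self_pos_iff.2 hu
  have h2 : Bᴴ * Matrix.comp _ _ _ _ ℂ (X.map fun Y => (Y : Matrix (Fin m) (Fin m) ℂ)) * B =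
      (star u ⬝ᵥ u) • X.map χ := by
    ext a b
    have := star_dotProduct_mulVec_of_mulVec_eq (hχ (X a b))
    rw [Matrix.smul_apply, map_apply, smul_eq_mul, mul_comm, ← this]
    have hB1 : ∀ c p, Bᴴ a (c, p) = if c = a then star (u p) else 0 := fun c p => by
      rw [conjTranspose_apply, hB, of_apply, apply_ite star, star_zero]
    have hB2 : ∀ d q, B (d, q) b = if d = b then u q else 0 := fun d q => rfl
    rw [Matrix.mul_assoc, mul_apply]
    simp only [Fintype.sum_prod_type, hB1, ite_mul, zero_mul, mul_apply, hB2, mul_ite, mul_zero,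
      Finset.sum_ite_irrel, Finset.sum_const_zero, Finset.sum_ite_eq', Finset.mem_univ, if_true,
      dotProduct, mulVec, Pi.star_apply, comp_apply, map_apply]
  rw [h2] at h1
  have h3 := h1.smul (inv_nonneg.2 hpos.le)
  rwa [smul_smul, inv_mul_cancel₀ hpos.ne', one_smul] at h3

theorem isCompletelyPositive_of_commute (hcomm : ∀ X ∈ 𝒜, ∀ Y ∈ 𝒜, X * Y = Y * X)
    {Ψ : 𝒜 →ₗ[ℂ] Matrix (Fin n) (Fin n) ℂ}
    (hΨ : ∀ X : 𝒜, (X : Matrix (Fin m) (Fin m) ℂ).PosSemidef → (Ψ X).PosSemidef) :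
    IsCompletelyPositive Ψ := by
  intro k X hX
  obtain ⟨ι, _, u, χ, hu, hχu, hχ⟩ := exists_eigenvector_characters hcomm
  obtain ⟨E, c, hc, hE, hsum⟩ := exists_projections_of_characters χ hχ
  have hEpos : ∀ i, (Ψ (E i)).PosSemidef := fun i => hΨ _ (by
    rw [hE i]
    exact posSemidef_conjTranspose_mul_self (E i : Matrix (Fin m) (Fin m) ℂ))
  have e : Matrix.comp _ _ _ _ ℂ (X.map fun Y => Ψ Y) =
      ∑ i, kroneckerMap (· * ·) ((c i : ℂ) • X.map (χ i)) (Ψ (E i)) := by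
    ext ⟨a, p⟩ ⟨b, q⟩
    have h1 : Ψ (X a b) = ∑ i, ((c i : ℂ) * χ i (X a b)) • Ψ (E i) := by
      conv_lhs => rw [hsum (X a b), map_sum]
      simp only [map_smul]
    have h2 := congrFun (congrFun h1 p) q
    simp only [Matrix.sum_apply, Matrix.smul_apply, smul_eq_mul] at h2
    simpa [Matrix.sum_apply] using h2
  rw [e]
  refine posSemidef_sum _ fun i _ => PosSemidef.kronecker ?_ (hEpos i)
  exact (posSemidef_map_character hX (hu i) (hχu i)).smul (by exact_mod_cast hc i)

end Commutative

theorem mainTheorem9 (m n : ℕ) :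
    (∀ (A : Matrix (Fin m) (Fin m) ℂ), A.PosSemidef →
      ∀ (Φ : Matrix (Fin m) (Fin m) ℂ →ₚ[ℂ] Matrix (Fin n) (Fin n) ℂ)
        (N : Seminorm ℂ (Matrix (Fin n) (Fin n) ℂ)), IsSymmetricNorm N →
      ∀ α : ℝ, 0 < α →
        LogConvexOn (Set.Ioi (0 : ℝ) ×ˢ (Set.univ : Set ℝ))
          (fun x : ℝ × ℝ => N (psdPow (Φ (psdPow A (x.2 / x.1))) (α * x.1)))) ∧
    (∀ (𝒜 : NonUnitalStarSubalgebra ℂ (Matrix (Fin m) (Fin m) ℂ)),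
      (∀ X ∈ 𝒜, ∀ Y ∈ 𝒜, X * Y = Y * X) →
      ∀ Ψ : 𝒜 →ₗ[ℂ] Matrix (Fin n) (Fin n) ℂ,
        (∀ X : 𝒜, (X : Matrix (Fin m) (Fin m) ℂ).PosSemidef → (Ψ X).PosSemidef) →
        IsCompletelyPositive Ψ) :=
  ⟨fun _ hA Φ _ hN _ hα => logConvexOn_norm_psdPow hA Φ hN hα,
    fun _ hcomm _ hΨ => isCompletelyPositive_of_commute hcomm hΨ⟩
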